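/- Let $p$ be an odd prime and let $1\le k\le n$ be integers. Let $W_n$ be the $n$-fold iterated wreath product of $\mathbb F_p$ (a Sylow $p$-subgroup of $\mathrm{Sym}(p^n)$), realized as the group of permutations of $\mathbb F_p^n$ generated by the translations $$f\Delta_i\colon (x_1,\dots,x_n)\mapsto (x_1,\dots,x_n)-f(x_1,\dots,x_{i-1})\,e_i ,\qquad 1\le i\le n,\quad f\colon \mathbb F_p^{i-1}\to\mathbb F_p ,$$ where $e_i$ is the $i$-th vector of the canonical basis. Let $B_i=\{f\Delta_i\mid f\colon\mathbb F_p^{i-1}\to\mathbb F_p\}$ be the $i$-th base subgroup, so that $W_n=B_1B_2\cdots B_n$, and let $\gamma_1(W_n)=W_n$, $\gamma_{m+1}(W_n)=[\gamma_m(W_n),W_n]$ be the lower central series. The product $B_{k+1}\cdots B_n$ is understood to be trivial if $k=n$. (a) If $N$ is a normal subgroup of $W_n$ with $N\subseteq B_k\cdots B_n$ and $N\not\subseteq B_{k+1}\cdots B_n$, then $\gamma_{p^{k-1}+1}(W_n)\subseteq N$ and $$|N:\gamma_{p^{k-1}+1}(W_n)|\le \bigl(p^{p^{k-1}}\bigr)^{n-k+1}.$$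 (b) For every nonzero function $f\colon\mathbb F_p^{k-1}\to\mathbb F_p$ and every $h\in B_{k+1}\cdots B_n$, the normal closure in $W_n$ of the element $f\Delta_k\cdot h$ contains $\gamma_{p^{k-1}+1}(W_n)$. -/

import Mathlib

open scoped Pointwise

namespace IteratedWreath

variable {p n : ℕ}

/-- The first `i` coordinates `(x_1, …, x_i)` of a point `x` of `F_p^n`. -/
def initial (i : Fin n) (x : Fin n → ZMod p) : Fin i → ZMod p :=
  fun j => x (j.castLE i.isLt.le)

/-- Coordinates are numbered from `0` in `Fin n`, so for `i = k - 1` this is the permutation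
`x ↦ x - f(x_1, …, x_{k-1}) e_k` of `F_p^n`, for a function `f : F_p^{k-1} → F_p`. -/
def translation (i : Fin n) (f : (Fin i → ZMod p) → ZMod p) : Equiv.Perm (Fin n → ZMod p) where
  toFun x := Function.update x i (x i - f (initial i x))
  invFun x := Function.update x i (x i + f (initial i x))
  left_inv x := by
    have h : ∀ c, initial i (Function.update x i c) = initial i x := by
      intro c; funext j; simp only [initial]
      exact Function.update_of_ne (Fin.ne_of_lt j.isLt) _ _
    simp [h]
  right_inv x := by
    have h : ∀ c, initial i (Function.update x i c) = initial i x := by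
      intro c; funext j; simp only [initial]
      exact Function.update_of_ne (Fin.ne_of_lt j.isLt) _ _
    simp [h]

variable (p n) in
/-- The group `W_n`, the `n`-fold iterated wreath product of `F_p`, in its faithful action on
`F_p^n`: it is generated by all the permutations `x ↦ x - f(x_1, …, x_{k-1}) e_k`. -/
def W : Subgroup (Equiv.Perm (Fin n → ZMod p)) :=
  Subgroup.closure {σ | ∃ (i : Fin n) (f : (Fin i → ZMod p) → ZMod p), σ = translation i f}

/-- The element `f Δ_k` of `W_n`, where `k = i + 1` and `f : F_p^{k-1} → F_p`. -/
def delta (i : Fin n) (f : (Fin i → ZMod p) → ZMod p) : W p n :=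
  ⟨translation i f, Subgroup.subset_closure ⟨i, f, rfl⟩⟩

theorem delta_apply (i : Fin n) (f : (Fin i → ZMod p) → ZMod p) (x : Fin n → ZMod p) :
    (delta i f : Equiv.Perm (Fin n → ZMod p)) x =
      Function.update x i (x i - f (initial i x)) := rfl

theorem initial_update (i j : Fin n) (h : i ≤ j) (x : Fin n → ZMod p) (c : ZMod p) :
    initial i (Function.update x j c) = initial i x := by
  funext l
  exact Function.update_of_ne (Fin.ne_of_lt (lt_of_lt_of_le (Fin.lt_def.2 l.isLt) h)) _ _

theorem delta_add (i : Fin n) (f g : (Fin i → ZMod p) → ZMod p) :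
    delta i (f + g) = delta i f * delta i g := by
  apply Subtype.ext
  ext1 x
  simp only [Subgroup.coe_mul, Equiv.Perm.mul_apply, delta_apply, initial_update i i le_rfl,
    Function.update_self, Function.update_idem, Pi.add_apply]
  congr 1
  ring

theorem delta_zero (i : Fin n) : delta i (0 : (Fin i → ZMod p) → ZMod p) = 1 := by
  apply Subtype.ext
  ext1 x
  simp [delta_apply]

theorem delta_neg (i : Fin n) (f : (Fin i → ZMod p) → ZMod p) :
    delta i (-f) = (delta i f)⁻¹ := by
  rw [eq_inv_iff_mul_eq_one, ← delta_add, neg_add_cancel, delta_zero]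

theorem delta_injective (i : Fin n) :
    Function.Injective (delta i : ((Fin i → ZMod p) → ZMod p) → W p n) := by
  intro f g h
  funext y
  let x : Fin n → ZMod p := fun j => if hj : j < i then y ⟨j, hj⟩ else 0
  have hx : initial i x = y := by
    funext j
    have hj : Fin.castLE i.isLt.le j < i := Fin.lt_def.2 j.isLt
    simp only [initial, x, dif_pos hj]
    rfl
  have := congrArg (fun w : W p n => (w : Equiv.Perm (Fin n → ZMod p)) x i) h
  simpa [delta_apply, hx] using this

variable (p) in
/-- The base subgroup `B_k = {f Δ_k | f : F_p^{k-1} → F_p}` of `W_n`, where `k = i + 1`. -/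
def base (i : Fin n) : Subgroup (W p n) where
  carrier := Set.range (delta i)
  one_mem' := ⟨0, delta_zero i⟩
  mul_mem' := by
    rintro _ _ ⟨f, rfl⟩ ⟨g, rfl⟩
    exact ⟨f + g, delta_add i f g⟩
  inv_mem' := by
    rintro _ ⟨f, rfl⟩
    exact ⟨-f, delta_neg i f⟩

variable (p n) in
/-- The subgroup `B_k B_{k+1} ⋯ B_n` of `W_n`, for `k ≥ 1`; it is trivial for `k = n + 1`.
It is defined as the subgroup generated by `B_k, …, B_n`; see `coe_tail` and `tail_eq_bot` for the
description as a product of subgroups. -/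
def tail (k : ℕ) : Subgroup (W p n) := ⨆ (i : Fin n) (_ : k ≤ (i : ℕ) + 1), base p i

/-- The term `γ_m(G)` of the lower central series in the numbering `γ_1(G) = G`,
`γ_{m+1}(G) = [γ_m(G), G]`, for `m ≥ 1`. -/
abbrev gamma (G : Type*) [Group G] (m : ℕ) : Subgroup G :=
  (⊤ : Subgroup G).lowerCentralSeries (m - 1)

theorem base_le_tail (i : Fin n) {k : ℕ} (h : k ≤ (i : ℕ) + 1) : base p i ≤ tail p n k :=
  le_iSup₂_of_le i h le_rfl

theorem tail_eq_bot : tail p n (n + 1) = ⊥ := by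
  refine le_bot_iff.1 (iSup₂_le fun i hi => ?_)
  have := i.isLt
  omega

theorem tail_one : tail p n 1 = ⊤ := by
  refine (eq_top_iff).2 fun w _ => ?_
  obtain ⟨σ, hσ⟩ := w
  have key : W p n ≤ (tail p n 1).map (W p n).subtype := by
    refine (Subgroup.closure_le _).2 ?_
    rintro _ ⟨i, f, rfl⟩
    exact ⟨delta i f, base_le_tail i (by omega) ⟨f, rfl⟩, rfl⟩
  obtain ⟨v, hv, hvσ⟩ := key hσ
  have : v = ⟨σ, hσ⟩ := Subtype.ext hvσ
  exact this ▸ hv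

/-- `f Δ_j` is carried into `B_j` by conjugation with `g Δ_i`, for `i < j`. -/
theorem delta_conj (i j : Fin n) (hij : i < j) (g : (Fin i → ZMod p) → ZMod p)
    (f : (Fin j → ZMod p) → ZMod p) :
    ∃ f', delta i g * delta j f * (delta i g)⁻¹ = delta j f' := by
  let i' : Fin j := ⟨i, hij⟩
  refine ⟨fun y => f (Function.update y i' (y i' + g (fun l => y ⟨l, l.isLt.trans hij⟩))), ?_⟩
  rw [mul_inv_eq_iff_eq_mul]
  apply Subtype.ext
  ext1 x
  simp only [Subgroup.coe_mul, Equiv.Perm.mul_apply, delta_apply]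
  rw [initial_update i j hij.le, Function.update_of_ne hij.ne, Function.update_of_ne hij.ne',
    Function.update_comm hij.ne']
  congr 3
  funext l
  by_cases hl : l = i'
  · subst hl
    simp only [Function.update_self]
    simp only [initial, i']
    rw [show Fin.castLE j.isLt.le ⟨i, hij⟩ = i from rfl, Function.update_self]
    have : (fun l : Fin i => Function.update x i (x i - g (initial i x))
        (Fin.castLE j.isLt.le ⟨l, l.isLt.trans hij⟩)) = initial i x := by
      funext m
      exact Function.update_of_ne (Fin.ne_of_lt m.isLt) _ _
    rw [this]
    ring
  · rw [Function.update_of_ne hl]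
    simp only [initial]
    rw [Function.update_of_ne]
    intro h
    have h2 : (l : ℕ) = i := congrArg (fun m : Fin n => (m : ℕ)) h
    exact hl (Fin.ext h2)

theorem base_le_normalizer (i : Fin n) (k : ℕ) (h : (i : ℕ) + 1 < k) :
    base p i ≤ Subgroup.normalizer (tail p n k : Set (W p n)) := by
  have key : ∀ w ∈ base p i, ∀ v ∈ tail p n k, w * v * w⁻¹ ∈ tail p n k := by
    rintro _ ⟨g, rfl⟩ v hv
    have : tail p n k ≤ (tail p n k).comap (MulAut.conj (delta i g)).toMonoidHom := by
      refine iSup₂_le fun j hj => ?_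
      rintro _ ⟨f, rfl⟩
      obtain ⟨f', hf'⟩ := delta_conj i j (Fin.lt_def.2 (by omega)) g f
      refine base_le_tail j hj ⟨f', ?_⟩
      simpa using hf'.symm
    simpa using this hv
  intro w hw
  rw [Subgroup.mem_normalizer_iff]
  refine fun v => ⟨key w hw v, fun hv => ?_⟩
  have := key w⁻¹ (inv_mem hw) _ hv
  simpa [mul_assoc] using this

/-- As sets, `B_k ⋯ B_n = B_k · (B_{k+1} ⋯ B_n)`, where `k = i + 1`. Together with `tail_one` and
`tail_eq_bot`, this gives `W_n = B_1 ⋯ B_n`. -/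
theorem coe_tail (i : Fin n) :
    (tail p n ((i : ℕ) + 1) : Set (W p n)) = (base p i : Set (W p n)) * tail p n ((i : ℕ) + 2) := by
  rw [← Subgroup.coe_mul_of_left_le_normalizer_right _ _ (base_le_normalizer i _ (by omega))]
  congr 1
  refine le_antisymm (iSup₂_le fun j hj => ?_) (sup_le (base_le_tail i le_rfl) ?_)
  · rcases eq_or_ne j i with rfl | hne
    · exact le_sup_left
    · have : (j : ℕ) ≠ i := fun h => hne (Fin.ext h)
      exact le_sup_of_le_right (base_le_tail j (by omega))
  · exact iSup₂_le fun j hj => base_le_tail j (by omega)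

/-- `B_k` meets `B_{k+1} ⋯ B_n` trivially, where `k = i + 1`. -/
theorem base_inf_tail (i : Fin n) : base p i ⊓ tail p n ((i : ℕ) + 2) = ⊥ := by
  let S : Subgroup (W p n) :=
    { carrier := {w | ∀ x, (w : Equiv.Perm (Fin n → ZMod p)) x i = x i}
      one_mem' := fun x => rfl
      mul_mem' := fun {a b} ha hb x => (ha _).trans (hb x)
      inv_mem' := fun {a} ha x => by
        have := ha ((a⁻¹ : W p n).1 x)
        rw [← this]
        simp }
  have hS : tail p n ((i : ℕ) + 2) ≤ S := by
    refine iSup₂_le fun j hj => ?_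
    rintro _ ⟨f, rfl⟩ x
    exact Function.update_of_ne (fun h => by subst h; omega) _ _
  refine (eq_bot_iff).2 ?_
  rintro _ ⟨⟨f, rfl⟩, hf⟩
  have h0 := hS hf
  rw [Subgroup.mem_bot, ← delta_zero i]
  apply Subtype.ext
  ext1 x
  have := h0 x
  rw [delta_apply, Function.update_self] at this
  simp only [delta_apply, Pi.zero_apply, this, sub_zero]

end IteratedWreath

/-!
Write `T = B_k ⋯ B_n`, which is `tail p n k`, and let `i = k - 1`, so that `B_k` is `base p i`;
the lemmas on a fixed `T` are indexed by `i`. Everything follows from the equality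
`γ_{p ^ (k - 1) + 1}(W_n) = [T, T]` and from the fact that `[T, T] = [M, T]` for each normal
subgroup `M` of `W_n` that is in `T`, but not in `B_{k+1} ⋯ B_n`. (In terms of wreath
products, `T` is a direct power of `W_{n-k+1}`, indexed by the `p ^ (k - 1)` points of
`F_p^{k-1}`.)

The equality `[T, T] = [M, T]` is `commutator_tail_le`. First, `M` and `T` have the same orbits
(`exists_mem_apply_eq`). Since elements of a base subgroup whose function is supported at one
point are permuted by conjugation like the points, up to later base subgroups, `[M, T]` contains
`[T, B]` modulo the later base subgroups, for each base subgroup `B` after `B_k`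
(`commutator_tail_base_le`). This makes `T ⧸ [M, T]` abelian by induction along the base
subgroups: up to factors that are already known to be central, two functions of different base
subgroups may be moved to disjoint supports, where their translations commute. For functions in
`B_k` this motion is not available, but there the elements of `M`, which are central by
definition, suffice.

Upper bound for `γ`: in `W_n ⧸ [T, T]`, the image of each `B_j`, `j ≥ k`, is normal and, since `T`
has `p ^ (k - 1)` orbits on `F_p^{j-1}`, of order at most `p ^ p ^ (k - 1)` (`card_map_base_le`).
In a `p`-group such a subgroup is centralized in `p ^ (k - 1)` steps
(`iteratedCommutator_eq_bot`), and the complement `B_1 ⋯ B_{k-1}` of `T` has smaller class by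
induction. The same orders bound the index of `[T, T]` in `T` (`commutator_tail_relIndex_le`).

Lower bound for `γ`: the constant translation in `B_k` is in `γ_{p ^ (k - 1)}(W_n)`
(`delta_mem_lowerCentralSeries`). With `M` the normal closure of this translation, this gives
`[T, T] = [M, T] ≤ γ_{p ^ (k - 1) + 1}(W_n)`.
-/

namespace IteratedWreath

open scoped commutatorElement

variable {p n : ℕ}

/-! ### The action on points -/

theorem initial_eq_iff {j : Fin n} {x y : Fin n → ZMod p} :
    initial j x = initial j y ↔ ∀ l : Fin n, (l : ℕ) < j → x l = y l :=
  ⟨fun h l hl => congrFun h ⟨l, hl⟩, fun h => funext fun l => h _ l.isLt⟩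

theorem initial_surjective (j : Fin n) :
    Function.Surjective (initial j : (Fin n → ZMod p) → Fin j → ZMod p) := fun y =>
  ⟨fun l => if hl : (l : ℕ) < j then y ⟨l, hl⟩ else 0, funext fun l => by simp [initial]⟩

theorem delta_apply_self (i : Fin n) (f : (Fin i → ZMod p) → ZMod p) (x : Fin n → ZMod p) :
    (delta i f).1 x i = x i - f (initial i x) := by
  rw [delta_apply, Function.update_self]

theorem delta_apply_of_ne {i l : Fin n} (h : l ≠ i) (f : (Fin i → ZMod p) → ZMod p)
    (x : Fin n → ZMod p) : (delta i f).1 x l = x l := by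
  rw [delta_apply, Function.update_of_ne h]

theorem delta_inv_apply (i : Fin n) (f : (Fin i → ZMod p) → ZMod p) (x : Fin n → ZMod p) :
    ((delta i f)⁻¹ : W p n).1 x = Function.update x i (x i + f (initial i x)) := rfl

theorem mul_apply (v w : W p n) (x : Fin n → ZMod p) : (v * w).1 x = v.1 (w.1 x) := rfl

@[simp] theorem apply_inv_apply (w : W p n) (x : Fin n → ZMod p) : w.1 ((w⁻¹).1 x) = x :=
  Equiv.apply_symm_apply w.1 x

@[simp] theorem inv_apply_apply (w : W p n) (x : Fin n → ZMod p) : (w⁻¹).1 (w.1 x) = x :=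
  Equiv.symm_apply_apply w.1 x

theorem ext_apply {v w : W p n} (h : ∀ x l, v.1 x l = w.1 x l) : v = w :=
  Subtype.ext (Equiv.ext fun x => funext (h x))

/-- The permutations in `W_n` are triangular: the amount by which the coordinate `j` of a point is
moved depends on the preceding coordinates only. -/
theorem apply_sub_eq (w : W p n) {j : Fin n} {x y : Fin n → ZMod p}
    (h : ∀ l : Fin n, (l : ℕ) < j → x l = y l) : w.1 x j - x j = w.1 y j - y j := by
  obtain ⟨σ, hσ⟩ := w
  change σ x j - x j = σ y j - y j
  induction hσ using Subgroup.closure_induction generalizing j x y with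
  | mem σ hσ =>
    obtain ⟨i, f, rfl⟩ := hσ
    change (delta i f).1 x j - x j = (delta i f).1 y j - y j
    rcases eq_or_ne j i with rfl | hne
    · rw [delta_apply_self, delta_apply_self, initial_eq_iff.2 h]; ring
    · rw [delta_apply_of_ne hne, delta_apply_of_ne hne]; ring
  | one => simp
  | mul a b _ _ ha hb =>
    have hb' : ∀ l : Fin n, (l : ℕ) < j → b x l = b y l := fun l hl => by
      have := hb (j := l) fun m hm => h m (hm.trans hl)
      rw [h l hl] at this
      exact sub_left_injective this
    have h1 := ha hb'
    have h2 := hb h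
    rw [Equiv.Perm.mul_apply, Equiv.Perm.mul_apply]
    linear_combination h1 + h2
  | inv a _ ha =>
    have ainv : ∀ u, a (a⁻¹ u) = u := Equiv.apply_symm_apply a
    have key : ∀ k : ℕ, ∀ l : Fin n, (l : ℕ) < k → (l : ℕ) < j → a⁻¹ x l = a⁻¹ y l := by
      intro k
      induction k with
      | zero => intro l hl; omega
      | succ k ih =>
        intro l hl hlj
        have := ha (j := l) (x := a⁻¹ x) (y := a⁻¹ y)
          fun m hm => ih m (by omega) (by omega)
        simp only [ainv, h l hlj] at this
        exact sub_right_injective this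
    have := ha (j := j) (x := a⁻¹ x) (y := a⁻¹ y) fun l hl => key _ l hl hl
    simp only [ainv] at this
    linear_combination -this

theorem apply_agree (w : W p n) {k : ℕ} {x y : Fin n → ZMod p}
    (h : ∀ l : Fin n, (l : ℕ) < k → x l = y l) (l : Fin n) (hl : (l : ℕ) < k) :
    w.1 x l = w.1 y l := by
  have := apply_sub_eq w (j := l) fun m hm => h m (hm.trans hl)
  rw [h l hl] at this
  exact sub_left_injective this

theorem initial_apply_congr (w : W p n) {j : Fin n} {x y : Fin n → ZMod p}
    (h : initial j x = initial j y) : initial j (w.1 x) = initial j (w.1 y) :=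
  initial_eq_iff.2 (apply_agree w (initial_eq_iff.1 h))

/-- `B_{k+1} ⋯ B_n` consists of the elements of `W_n` that fix the first `k` coordinates of every
point. -/
theorem mem_tail_iff {k : ℕ} {w : W p n} :
    w ∈ tail p n (k + 1) ↔ ∀ x (l : Fin n), (l : ℕ) < k → w.1 x l = x l := by
  constructor
  · let S : Subgroup (W p n) :=
      { carrier := {w | ∀ x (l : Fin n), (l : ℕ) < k → w.1 x l = x l}
        one_mem' := fun x l _ => rfl
        mul_mem' := fun {a b} ha hb x l hl => (ha _ l hl).trans (hb x l hl)
        inv_mem' := fun {a} ha x l hl => by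
          have := ha ((a⁻¹ : W p n).1 x) l hl
          rw [← this, apply_inv_apply] }
    have hS : tail p n (k + 1) ≤ S := by
      refine iSup₂_le fun j hj => ?_
      rintro _ ⟨f, rfl⟩ x l hl
      exact delta_apply_of_ne (fun h => by subst h; omega) _ _
    exact fun hw => hS hw
  · obtain ⟨d, hd⟩ : ∃ d, n ≤ k + d := ⟨n, by omega⟩
    induction d generalizing k w with
    | zero =>
      intro h
      have : w = 1 := ext_apply fun x l => h x l (by omega)
      exact this ▸ one_mem _
    | succ d ih =>
      intro h
      rcases le_or_gt n k with hk | hk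
      · exact (ih (by omega) h)
      let j : Fin n := ⟨k, hk⟩
      -- The component of `w` in `B_{k+1}` is read off from its action on the coordinate `k`.
      let f : (Fin j → ZMod p) → ZMod p := fun y =>
        Function.surjInv (initial_surjective j) y j -
          w.1 (Function.surjInv (initial_surjective j) y) j
      have hf : ∀ x, f (initial j x) = x j - w.1 x j := fun x => by
        have h1 := initial_eq_iff.1 (Function.surjInv_eq (initial_surjective j) (initial j x))
        have h2 := apply_sub_eq w h1
        simp only [f]
        linear_combination -h2
      have hmem : (delta j f)⁻¹ * w ∈ tail p n (k + 1 + 1) := by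
        refine ih (by omega) fun x l hl => ?_
        rw [mul_apply, delta_inv_apply]
        rcases eq_or_ne l j with rfl | hne
        · rw [Function.update_self, initial_eq_iff.2 fun m hm => h x m hm, hf]; ring
        · rw [Function.update_of_ne hne]
          have : (l : ℕ) ≠ k := fun h => hne (Fin.ext h)
          exact h x l (by omega)
      have hle : tail p n (k + 1 + 1) ≤ tail p n (k + 1) :=
        iSup₂_le fun i hi => base_le_tail i (by omega)
      have := mul_mem (base_le_tail (p := p) j (le_refl (k + 1)) ⟨f, rfl⟩) (hle hmem)
      rwa [mul_inv_cancel_left] at this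

theorem tail_antitone : Antitone (tail p n) := fun _ _ h =>
  iSup₂_le fun i hi => base_le_tail i (by omega)

theorem delta_mem_tail (i : Fin n) (f : (Fin i → ZMod p) → ZMod p) {k : ℕ} (h : k ≤ (i : ℕ) + 1) :
    delta i f ∈ tail p n k :=
  base_le_tail i h ⟨f, rfl⟩

instance tail_normal (k : ℕ) : (tail p n (k + 1)).Normal where
  conj_mem v hv w := by
    rw [mem_tail_iff] at hv ⊢
    intro x l hl
    have := apply_agree w (hv ((w⁻¹).1 x)) l hl
    rwa [apply_inv_apply] at this

/-- The decomposition of an element of `B_k ⋯ B_n` into its components in `B_k` and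
`B_{k+1} ⋯ B_n`, where `k = i + 1`. -/
theorem exists_eq_delta_mul {i : Fin n} {w : W p n} (hw : w ∈ tail p n ((i : ℕ) + 1)) :
    ∃ f, ∃ h ∈ tail p n ((i : ℕ) + 2), w = delta i f * h := by
  have : w ∈ (tail p n ((i : ℕ) + 1) : Set (W p n)) := hw
  rw [coe_tail] at this
  obtain ⟨_, ⟨f, rfl⟩, h, hh, rfl⟩ := this
  exact ⟨f, h, hh, rfl⟩

/-- The action of a conjugate of an element of `base p j` on the coordinates up to `j`. -/
theorem conj_delta_apply (w : W p n) (j : Fin n) (g : (Fin j → ZMod p) → ZMod p)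
    (x : Fin n → ZMod p) :
    (∀ l : Fin n, (l : ℕ) < j → (w * delta j g * w⁻¹).1 x l = x l) ∧
      (w * delta j g * w⁻¹).1 x j = x j - g (initial j ((w⁻¹).1 x)) := by
  have h : ∀ l : Fin n, (l : ℕ) < j → (delta j g).1 ((w⁻¹).1 x) l = (w⁻¹).1 x l :=
    fun l hl => delta_apply_of_ne (fun e => by subst e; omega) _ _
  constructor
  · intro l hl
    have := apply_agree w h l hl
    rwa [apply_inv_apply] at this
  · have := apply_sub_eq w h
    rw [apply_inv_apply, delta_apply_self] at this
    rw [mul_apply, mul_apply]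
    linear_combination this

theorem conj_delta_eq_of_fix {j : Fin n} {t : W p n}
    (ht : ∀ x (l : Fin n), j < l → t.1 x l = x l) {g g' : (Fin j → ZMod p) → ZMod p}
    (h : ∀ x, g (initial j ((t⁻¹).1 x)) = g' (initial j x)) :
    t * delta j g * t⁻¹ = delta j g' := by
  refine ext_apply fun x l => ?_
  obtain ⟨h1, h2⟩ := conj_delta_apply t j g x
  rcases lt_trichotomy l j with hl | rfl | hl
  · rw [h1 l hl, delta_apply_of_ne hl.ne]
  · rw [h2, delta_apply_self, h]
  · rw [mul_apply, mul_apply, ht _ l hl, delta_apply_of_ne hl.ne', delta_apply_of_ne hl.ne',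
      ← ht ((t⁻¹).1 x) l hl, apply_inv_apply]

theorem conj_delta_eq {i j : Fin n} (hij : i < j) (v : (Fin i → ZMod p) → ZMod p)
    {g g' : (Fin j → ZMod p) → ZMod p}
    (h : ∀ x, g (initial j (Function.update x i (x i + v (initial i x)))) = g' (initial j x)) :
    delta i v * delta j g * (delta i v)⁻¹ = delta j g' :=
  conj_delta_eq_of_fix (fun x _ hl => delta_apply_of_ne (hij.trans hl).ne' v x) h

theorem commute_delta_self (i : Fin n) (f g : (Fin i → ZMod p) → ZMod p) :
    Commute (delta i f) (delta i g) := by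
  change _ * _ = _ * _
  rw [← delta_add, ← delta_add, add_comm]

/-- If `v` vanishes at `z`, then the translation given by `v` commutes with those of later
coordinates that move only the points whose preceding coordinates agree with those of `z`. -/
theorem commute_delta_single {i j : Fin n} (hij : i < j) {v : (Fin i → ZMod p) → ZMod p}
    {z : Fin n → ZMod p} (hv : v (initial i z) = 0) (c : ZMod p) :
    Commute (delta i v) (delta j (Pi.single (initial j z) c)) := by
  have hij' : (i : ℕ) < j := hij
  have := conj_delta_eq hij v (g := Pi.single (initial j z) c) (g' := Pi.single (initial j z) c) ?_
  · exact mul_inv_eq_iff_eq_mul.1 this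
  intro x
  by_cases hx : initial i x = initial i z
  · rw [hx, hv, add_zero, Function.update_eq_self]
  · have h1 : initial j x ≠ initial j z := fun h =>
      hx (initial_eq_iff.2 fun l hl => initial_eq_iff.1 h l (hl.trans hij'))
    have h2 : initial j (Function.update x i (x i + v (initial i x))) ≠ initial j z := fun h =>
      hx (initial_eq_iff.2 fun l hl => by
        rw [← initial_eq_iff.1 h l (hl.trans hij'), Function.update_of_ne]
        exact fun e => by subst e; omega)
    rw [Pi.single_eq_of_ne h1, Pi.single_eq_of_ne h2]

/-- A base subgroup is generated by its elements whose function is supported at one point. -/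
theorem base_le_of_single_mem [NeZero p] {j : Fin n} {H : Subgroup (W p n)}
    (h : ∀ (z : Fin n → ZMod p) (c : ZMod p), delta j (Pi.single (initial j z) c) ∈ H) :
    base p j ≤ H := by
  let A : AddSubgroup ((Fin j → ZMod p) → ZMod p) :=
    { carrier := {f | delta j f ∈ H}
      zero_mem' := by simp [delta_zero, one_mem]
      add_mem' := fun {a b} ha hb => by
        simpa [delta_add] using mul_mem ha hb
      neg_mem' := fun {a} ha => by
        simpa [delta_neg] using ha }
  rintro _ ⟨f, rfl⟩
  refine AddSubgroup.pi_mem_of_single_mem (H := A) f fun y => ?_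
  obtain ⟨z, rfl⟩ := initial_surjective j y
  exact h z _

/-- `B_{i+1} ⋯ B_k` acts transitively on the first `k` coordinates of the points with given first
`i` coordinates. -/
theorem exists_mem_tail_apply_eq {i : ℕ} {x y : Fin n → ZMod p}
    (h : ∀ l : Fin n, (l : ℕ) < i → x l = y l) (k : ℕ) :
    ∃ w ∈ tail p n (i + 1), (∀ l : Fin n, (l : ℕ) < k → w.1 x l = y l) ∧
      ∀ z (l : Fin n), k ≤ (l : ℕ) → w.1 z l = z l := by
  induction k with
  | zero => exact ⟨1, one_mem _, fun l hl => by omega, fun _ _ _ => rfl⟩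
  | succ k ih =>
    obtain ⟨w, hw, hwk, hfix⟩ := ih
    rcases lt_or_ge k i with hk | hk
    · exact ⟨1, one_mem _, fun l hl => h l (by omega), fun _ _ _ => rfl⟩
    rcases le_or_gt n k with hn | hn
    · exact ⟨w, hw, fun l hl => hwk l (by omega), fun z l _ => hfix z l (by omega)⟩
    refine ⟨delta ⟨k, hn⟩ (fun _ => w.1 x ⟨k, hn⟩ - y ⟨k, hn⟩) * w,
      mul_mem (delta_mem_tail _ _ (by simpa using hk)) hw, fun l hl => ?_, fun z l hl => ?_⟩ <;>
      rw [mul_apply]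
    · rcases eq_or_ne l ⟨k, hn⟩ with rfl | hne
      · rw [delta_apply_self]; ring
      · rw [delta_apply_of_ne hne]
        exact hwk l (by have : (l : ℕ) ≠ k := fun h => hne (Fin.ext h); omega)
    · rw [delta_apply_of_ne fun e => by subst e; simp at hl]
      exact hfix z l (by omega)

/-! ### Normal subgroups inside a tail -/

section NormalSubgroup

variable [Fact p.Prime] {i : Fin n} {M : Subgroup (W p n)} [M.Normal]

/-- A normal subgroup in `B_k ⋯ B_n`, but not in `B_{k+1} ⋯ B_n`, moves the coordinate `k` of each
point by an arbitrary amount. -/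
theorem exists_mem_apply_eq_sub (hM : M ≤ tail p n ((i : ℕ) + 1))
    (hM' : ¬ M ≤ tail p n ((i : ℕ) + 2)) (z : Fin n → ZMod p) (d : ZMod p) :
    ∃ m ∈ M, m.1 z i = z i - d := by
  obtain ⟨w, hwM, hw⟩ := SetLike.not_le_iff_exists.1 hM'
  rw [mem_tail_iff] at hw
  push Not at hw
  obtain ⟨x, l, hl, hx⟩ := hw
  have hfix := fun m (hm : m ∈ M) => mem_tail_iff.1 (hM hm)
  obtain rfl : l = i := by
    by_contra hne
    have : (l : ℕ) ≠ i := fun h => hne (Fin.ext h)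
    exact hx (hfix w hwM x l (by omega))
  -- A conjugate of `w` moves the coordinate of `z` by the same amount as `w` does for `x`.
  obtain ⟨g, -, hg, -⟩ := exists_mem_tail_apply_eq (i := 0) (x := x) (y := z)
    (fun _ h => by omega) n
  have hgx : g.1 x = z := funext fun l => hg l l.isLt
  have hm0 : g * w * g⁻¹ ∈ M := Subgroup.Normal.conj_mem inferInstance w hwM g
  have hgz : (g⁻¹).1 z = x := by rw [← hgx, inv_apply_apply]
  have hmz : (g * w * g⁻¹).1 z l - z l = w.1 x l - x l := by
    have := apply_sub_eq g (j := l) (hfix w hwM x)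
    rw [mul_apply, mul_apply, hgz]
    rw [hgx] at this
    linear_combination this
  generalize g * w * g⁻¹ = m at hm0 hmz
  have hpow : ∀ s : ℕ, (m ^ s).1 z l = z l + s * (w.1 x l - x l) := by
    intro s
    induction s with
    | zero => simp
    | succ s ih =>
      have := apply_sub_eq m (j := l) (hfix _ (pow_mem hm0 s) z)
      rw [pow_succ', mul_apply, Nat.cast_succ]
      linear_combination this + ih + hmz
  have he : w.1 x l - x l ≠ 0 := sub_ne_zero.2 hx
  refine ⟨m ^ (-d / (w.1 x l - x l)).val, pow_mem hm0 _, ?_⟩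
  rw [hpow, ZMod.natCast_val, ZMod.cast_id, div_mul_cancel₀ _ he, sub_eq_add_neg]

/-- A normal subgroup in `B_k ⋯ B_n`, but not in `B_{k+1} ⋯ B_n`, has the same orbits as
`B_k ⋯ B_n`. -/
theorem exists_mem_apply_eq (hM : M ≤ tail p n ((i : ℕ) + 1))
    (hM' : ¬ M ≤ tail p n ((i : ℕ) + 2)) {j : ℕ} (hj : (i : ℕ) < j) {x y : Fin n → ZMod p}
    (h : ∀ l : Fin n, (l : ℕ) < i → x l = y l) :
    ∃ m ∈ M, ∀ l : Fin n, (l : ℕ) < j → m.1 x l = y l := by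
  have hfix := fun m (hm : m ∈ M) => mem_tail_iff.1 (hM hm)
  induction j, hj using Nat.le_induction generalizing x y with
  | base =>
    obtain ⟨m, hm, hmx⟩ := exists_mem_apply_eq_sub hM hM' x (x i - y i)
    refine ⟨m, hm, fun l hl => ?_⟩
    rcases eq_or_ne l i with rfl | hne
    · rw [hmx]; ring
    · have : (l : ℕ) ≠ i := fun h => hne (Fin.ext h)
      rw [hfix m hm x l (by omega), h l (by omega)]
  | succ j hij ih =>
    obtain ⟨m₁, hm₁, hz⟩ := ih h
    rcases le_or_gt n j with hn | hn
    · exact ⟨m₁, hm₁, fun l hl => hz l (by omega)⟩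
    have hij' : (i : ℕ) < j := hij
    let j' : Fin n := ⟨j, hn⟩
    set z := m₁.1 x with hzdef
    -- The commutator of an element of `M` that carries `b` to `z` with the element `g` that moves
    -- the coordinate `j` at `b` only is an element of `M` that moves this coordinate at `z`.
    let b : Fin n → ZMod p := Function.update z i (z i + 1)
    obtain ⟨m, hm, hmb⟩ := ih (x := b) (y := z) fun l hl =>
      Function.update_of_ne (fun e => by subst e; omega) _ _
    have hbz : initial j' z ≠ initial j' b := fun e => by
      have := initial_eq_iff.1 e i hij'
      simp [b] at this
    let g : W p n := delta j' (Pi.single (initial j' b) (z j' - y j'))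
    have hgz : (g⁻¹).1 z = z := by
      rw [delta_inv_apply, Pi.single_eq_of_ne hbz, add_zero, Function.update_eq_self]
    have hgM : m * (g * m⁻¹ * g⁻¹) * m₁ ∈ M :=
      mul_mem (mul_mem hm (Subgroup.Normal.conj_mem inferInstance _ (inv_mem hm) g)) hm₁
    refine ⟨_, hgM, fun l hl => ?_⟩
    have hval : (m * (g * m⁻¹ * g⁻¹) * m₁).1 x = (m * g * m⁻¹).1 z := by
      simp only [mul_apply, ← hzdef, hgz]
    obtain ⟨h1, h2⟩ := conj_delta_apply m j' (Pi.single (initial j' b) (z j' - y j')) z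
    rw [hval]
    rcases eq_or_ne l j' with rfl | hne
    · have hb : initial j' ((m⁻¹).1 z) = initial j' b := by
        rw [← inv_apply_apply m b]
        exact initial_apply_congr _ (initial_eq_iff.2 hmb).symm
      rw [h2, hb, Pi.single_eq_same]; ring
    · have : (l : ℕ) ≠ j := fun h => hne (Fin.ext h)
      rw [h1 l (show (l : ℕ) < j by omega), hz l (by omega)]

/-- Modulo the later base subgroups, conjugation with `w` permutes the elements of `base p j` whose
function is supported at one point in the same way as `w` permutes the points. -/
theorem conj_delta_single_mul_inv_mem (w : W p n) (j : Fin n) {z z' : Fin n → ZMod p}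
    (h : initial j (w.1 z) = initial j z') (c : ZMod p) :
    w * delta j (Pi.single (initial j z) c) * w⁻¹ * (delta j (Pi.single (initial j z') c))⁻¹ ∈
      tail p n ((j : ℕ) + 2) := by
  rw [mem_tail_iff (k := (j : ℕ) + 1)]
  intro x l hl
  set x' := ((delta j (Pi.single (initial j z') c))⁻¹ : W p n).1 x with hx'
  obtain ⟨h1, h2⟩ := conj_delta_apply w j (Pi.single (initial j z) c) x'
  rw [mul_apply, ← hx']
  have hlt : ∀ l : Fin n, (l : ℕ) < j → x' l = x l := fun l hl => by
    rw [hx', delta_inv_apply, Function.update_of_ne fun e => by subst e; omega]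
  rcases eq_or_ne l j with rfl | hne
  · have hiff : initial l ((w⁻¹).1 x') = initial l z ↔ initial l x = initial l z' := by
      rw [← initial_eq_iff.2 hlt, ← h]
      constructor
      · intro e
        simpa using initial_apply_congr w e
      · intro e
        simpa using initial_apply_congr w⁻¹ e
    have hself :
        x' l = x l + (Pi.single (initial l z') c : (Fin l → ZMod p) → ZMod p) (initial l x) := by
      rw [hx', delta_inv_apply, Function.update_self]
    rw [h2, hself]
    by_cases hx : initial l x = initial l z'
    · rw [hx, hiff.2 hx, Pi.single_eq_same, Pi.single_eq_same]; ring
    · rw [Pi.single_eq_of_ne hx, Pi.single_eq_of_ne (mt hiff.1 hx)]; ring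
  · have : (l : ℕ) ≠ j := fun h => hne (Fin.ext h)
    rw [h1 l (by omega), hlt l (by omega)]

/-- Modulo `[M, B_k ⋯ B_n]` and the base subgroups after `base p j`, all of `B_k ⋯ B_n` centralizes
`base p j`, since it has the same orbits as `M`. -/
theorem commutator_tail_base_le (hM : M ≤ tail p n ((i : ℕ) + 1))
    (hM' : ¬ M ≤ tail p n ((i : ℕ) + 2)) {j : Fin n} (hij : i < j) :
    ⁅tail p n ((i : ℕ) + 1), base p j⁆ ≤
      ⁅M, tail p n ((i : ℕ) + 1)⁆ ⊔ tail p n ((j : ℕ) + 2) := by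
  have hij' : (i : ℕ) < j := hij
  set L := ⁅M, tail p n ((i : ℕ) + 1)⁆ ⊔ tail p n ((j : ℕ) + 2) with hL
  have : L.Normal := by rw [hL]; infer_instance
  let π := QuotientGroup.mk' L
  rw [Subgroup.commutator_le]
  intro t ht
  suffices H : base p j ≤ (Subgroup.centralizer {π t}).comap π by
    intro g hg
    have := Subgroup.mem_centralizer_singleton_iff.1 (H hg)
    rw [← QuotientGroup.eq_one_iff, ← QuotientGroup.mk'_apply, map_commutatorElement]
    exact commutatorElement_eq_one_iff_mul_comm.2 this.symm
  refine base_le_of_single_mem fun z c => ?_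
  obtain ⟨m, hm, hmz⟩ := exists_mem_apply_eq hM hM' (j := j) hij' (x := z) (y := t.1 z)
    fun l hl => (mem_tail_iff.1 ht z l hl).symm
  set g := delta j (Pi.single (initial j z) c)
  set g' := delta j (Pi.single (initial j (t.1 z)) c)
  have e1 : π (t * g * t⁻¹ * g'⁻¹) = 1 := (QuotientGroup.eq_one_iff _).2
    (hL ▸ Subgroup.mem_sup_right (conj_delta_single_mul_inv_mem t j rfl c))
  have e2 : π (m * g * m⁻¹ * g'⁻¹) = 1 := (QuotientGroup.eq_one_iff _).2
    (hL ▸ Subgroup.mem_sup_right (conj_delta_single_mul_inv_mem m j (initial_eq_iff.2 hmz) c))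
  have e3 : π (m * g * m⁻¹ * g⁻¹) = 1 := (QuotientGroup.eq_one_iff _).2
    (hL ▸ Subgroup.mem_sup_left (Subgroup.commutator_mem_commutator hm
      (delta_mem_tail _ _ (by omega))))
  rw [map_mul, map_inv, mul_inv_eq_one] at e1 e2 e3
  rw [Subgroup.mem_comap, Subgroup.mem_centralizer_singleton_iff]
  have : π (t * g * t⁻¹) = π g := e1.trans (e2.symm.trans e3)
  rw [map_mul, map_inv, map_mul, mul_inv_eq_iff_eq_mul] at this
  exact this.symm

end NormalSubgroup

theorem tail_le_of_single_mem [NeZero p] {k : ℕ} {H : Subgroup (W p n)}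
    (h : ∀ b : Fin n, k ≤ (b : ℕ) + 1 → ∀ (z : Fin n → ZMod p) (c : ZMod p),
      delta b (Pi.single (initial b z) c) ∈ H) : tail p n k ≤ H :=
  iSup₂_le fun b hb => base_le_of_single_mem (h b hb)

/-- Commutation modulo `L` may be tested on functions supported at one point. -/
theorem commute_tail_of_commute_single [NeZero p] {k l : ℕ} {L : Subgroup (W p n)} [L.Normal]
    (h : ∀ a b : Fin n, k ≤ (a : ℕ) + 1 → l ≤ (b : ℕ) + 1 →
      ∀ (y z : Fin n → ZMod p) (d c : ZMod p),
      Commute (QuotientGroup.mk' L (delta a (Pi.single (initial a y) d)))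
        (QuotientGroup.mk' L (delta b (Pi.single (initial b z) c))))
    {t u : W p n} (ht : t ∈ tail p n k) (hu : u ∈ tail p n l) :
    Commute (QuotientGroup.mk' L t) (QuotientGroup.mk' L u) := by
  let C (g : W p n) := (Subgroup.centralizer {QuotientGroup.mk' L g}).comap (QuotientGroup.mk' L)
  have hC : ∀ {g g'}, g' ∈ C g ↔ Commute (QuotientGroup.mk' L g') (QuotientGroup.mk' L g) :=
    Subgroup.mem_centralizer_singleton_iff
  have h1 : ∀ a : Fin n, k ≤ (a : ℕ) + 1 → ∀ y d, tail p n l ≤ C (delta a (Pi.single _ d)) :=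
    fun a ha y d => tail_le_of_single_mem fun b hb z c => hC.2 (h a b ha hb y z d c).symm
  have h2 : tail p n k ≤ C u := tail_le_of_single_mem fun a ha y d =>
    hC.2 (hC.1 (h1 a ha y d hu)).symm
  exact hC.1 (h2 ht)

theorem commutator_tail_le_of_commute_single [NeZero p] {k : ℕ} {L : Subgroup (W p n)} [L.Normal]
    (h : ∀ a b : Fin n, k ≤ (a : ℕ) + 1 → a < b → ∀ (y z : Fin n → ZMod p) (d c : ZMod p),
      Commute (QuotientGroup.mk' L (delta a (Pi.single (initial a y) d)))
        (QuotientGroup.mk' L (delta b (Pi.single (initial b z) c)))) :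
    ⁅tail p n k, tail p n k⁆ ≤ L := by
  rw [Subgroup.commutator_le]
  intro t ht u hu
  rw [← QuotientGroup.eq_one_iff, ← QuotientGroup.mk'_apply, map_commutatorElement]
  refine (commute_tail_of_commute_single (fun a b ha hb y z d c => ?_) ht hu).commutator_eq
  rcases lt_trichotomy a b with hab | rfl | hab
  · exact h a b ha hab y z d c
  · exact (commute_delta_self a _ _).map _
  · exact (h b a hb hab z y c d).symm

/-- Since `B_k` is abelian, the commutator subgroup of `B_k ⋯ B_n` is in `B_{k+1} ⋯ B_n`. -/
theorem commutator_tail_le_tail_succ [NeZero p] (k : ℕ) :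
    ⁅tail p n (k + 1), tail p n (k + 1)⁆ ≤ tail p n (k + 2) := by
  refine commutator_tail_le_of_commute_single fun a b ha hab y z d c => ?_
  have hab' : (a : ℕ) < b := hab
  have : QuotientGroup.mk' (tail p n (k + 2)) (delta b (Pi.single (initial b z) c)) = 1 :=
    (QuotientGroup.eq_one_iff _).2 (delta_mem_tail _ _ (by omega))
  rw [this]
  exact Commute.one_right _

/-- The commutator subgroup of `B_k ⋯ B_n` is already generated, as a normal subgroup, by its
commutators with any normal subgroup of `W_n` in `B_k ⋯ B_n` that is not in `B_{k+1} ⋯ B_n`. -/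
theorem commutator_tail_le [Fact p.Prime] {i : Fin n} {M : Subgroup (W p n)} [M.Normal]
    (hM : M ≤ tail p n ((i : ℕ) + 1)) (hM' : ¬ M ≤ tail p n ((i : ℕ) + 2)) :
    ⁅tail p n ((i : ℕ) + 1), tail p n ((i : ℕ) + 1)⁆ ≤ ⁅M, tail p n ((i : ℕ) + 1)⁆ := by
  set T := tail p n ((i : ℕ) + 1) with hT
  suffices H : ∀ j : ℕ, (i : ℕ) < j → ⁅T, T⁆ ≤ ⁅M, T⁆ ⊔ tail p n (j + 1) by
    simpa [tail_eq_bot] using H n i.isLt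
  intro j hj
  induction j, hj using Nat.le_induction with
  | base =>
    exact (commutator_tail_le_tail_succ i).trans le_sup_right
  | succ j hij ih =>
    rcases le_or_gt n j with hn | hn
    · exact ih.trans (sup_le_sup_left (by
        have h1 : tail p n (j + 1) = ⊥ := le_bot_iff.1
          (tail_eq_bot (p := p) (n := n) ▸ tail_antitone (by omega))
        rw [h1]; exact bot_le) _)
    have hij' : (i : ℕ) < j := hij
    let j' : Fin n := ⟨j, hn⟩
    set L := ⁅M, T⁆ ⊔ tail p n (j + 1 + 1) with hL
    have hLn : L.Normal := by rw [hL]; infer_instance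
    have hLM : ⁅M, T⁆ ≤ L := le_sup_left
    have hLt : tail p n (j + 2) ≤ L := le_sup_right
    let π := QuotientGroup.mk' L
    have hπ : ∀ {w}, w ∈ L → π w = 1 := fun h => (QuotientGroup.eq_one_iff _).2 h
    have commute_iff : ∀ {u v}, ⁅u, v⁆ ∈ L → Commute (π u) (π v) := fun h =>
      commutatorElement_eq_one_iff_commute.1 (map_commutatorElement π _ _ ▸ hπ h)
    have hbase : ∀ t ∈ T, ∀ f, Commute (π t) (π (delta j' f)) := fun t ht f => commute_iff
      (commutator_tail_base_le hM hM' (j := j') hij'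
        (Subgroup.commutator_mem_commutator ht ⟨f, rfl⟩))
    -- By induction, the commutator subgroup of `T` is contained in `base p j'` modulo `L`.
    have hcomm : ∀ u ∈ ⁅T, T⁆, ∀ t ∈ T, Commute (π u) (π t) := by
      intro u hu t ht
      obtain ⟨k, hk, w, hw, rfl⟩ := Subgroup.mem_sup_of_normal_right.1 (ih hu)
      obtain ⟨f, h, hh, rfl⟩ := exists_eq_delta_mul (i := j') hw
      rw [map_mul, map_mul, hπ (hLM hk), hπ (hLt hh), one_mul, mul_one]
      exact (hbase t ht f).symm
    have hgt : ∀ a b : Fin n, i < a → a < b → ∀ (y z : Fin n → ZMod p) (d c : ZMod p),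
        Commute (π (delta a (Pi.single (initial a y) d)))
          (π (delta b (Pi.single (initial b z) c))) := by
      intro a b hia hab y z d c
      have hia' : (i : ℕ) < a := hia
      have hab' : (a : ℕ) < b := hab
      by_cases hyz : initial a z = initial a y
      swap
      · exact (commute_delta_single hab (Pi.single_eq_of_ne hyz _) c).map π
      -- Moving the support of the second function away from that of the first one changes the
      -- second element by a commutator of elements of `T` only.
      let z' := Function.update z i (z i + 1)
      have hne : initial a z' ≠ initial a y := fun e => by
        have := initial_eq_iff.1 (e.trans hyz.symm) i hia'
        simp [z'] at this
      set g := delta b (Pi.single (initial b z) c)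
      set g' := delta b (Pi.single (initial b z') c)
      set t := delta i (fun _ => (-1 : ZMod p))
      have htg : t * g * t⁻¹ = g' := by
        refine conj_delta_eq (hia.trans hab) _ fun x => ?_
        have : initial b (Function.update x i (x i + -1)) = initial b z ↔
            initial b x = initial b z' := by
          rw [initial_eq_iff, initial_eq_iff]
          refine forall₂_congr fun l _ => ?_
          rcases eq_or_ne l i with rfl | hl
          · simp only [z', Function.update_self]
            rw [← sub_eq_add_neg, sub_eq_iff_eq_add]
          · simp only [z', Function.update_of_ne hl]
        simp only [Pi.single_apply, this]
      have hmem : ⁅t, g⁆ ∈ ⁅T, T⁆ := Subgroup.commutator_mem_commutator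
        (delta_mem_tail _ _ (by omega)) (delta_mem_tail _ _ (by omega))
      have hg : g = ⁅t, g⁆⁻¹ * g' := by rw [commutatorElement_def, htg]; group
      have h1 := hcomm _ hmem (delta a (Pi.single (initial a y) d)) (delta_mem_tail _ _ (by omega))
      have h2 := (commute_delta_single hab
        (v := Pi.single (initial a y) d) (Pi.single_eq_of_ne hne _) c).map π
      rw [hg, map_mul, map_inv]
      exact h1.symm.inv_right.mul_right h2
    refine commutator_tail_le_of_commute_single fun a b ha hab y z d c => ?_
    rcases (show i ≤ a from Fin.le_def.2 (by omega)).lt_or_eq with hia | rfl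
    · exact hgt a b hia hab y z d c
    have hab' : (i : ℕ) < b := hab
    by_cases hyz : initial i z = initial i y
    swap
    · exact (commute_delta_single hab (Pi.single_eq_of_ne hyz _) c).map π
    -- An element of `M` agrees with the first element at `z`, up to factors that commute with the
    -- second one.
    obtain ⟨m, hm, hmz⟩ := exists_mem_apply_eq_sub hM hM' z d
    obtain ⟨f, h, hh, rfl⟩ := exists_eq_delta_mul (hM hm)
    have hfz : f (initial i z) = d := by
      have hhz := mem_tail_iff.1 hh z
      rw [mul_apply, delta_apply_self, hhz i (by omega),
        initial_eq_iff.2 fun l hl => hhz l (by omega)] at hmz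
      exact sub_right_injective hmz
    set s : (Fin i → ZMod p) → ZMod p := Pi.single (initial i y) d with hs
    have h0 : (f - s) (initial i z) = 0 := by
      rw [Pi.sub_apply, hfz, hs, hyz, Pi.single_eq_same, sub_self]
    have heq : delta i s = (delta i (f - s))⁻¹ * (delta i f * h) * h⁻¹ := by
      rw [mul_assoc, mul_inv_cancel_right, eq_inv_mul_iff_mul_eq, ← delta_add, sub_add_cancel]
    have h1 := (commute_delta_single hab h0 c).map π
    have h2 : Commute (π (delta i f * h)) (π (delta b (Pi.single (initial b z) c))) :=
      commute_iff (hLM (Subgroup.commutator_mem_commutator hm (delta_mem_tail _ _ (by omega))))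
    have h3 : Commute (π h) (π (delta b (Pi.single (initial b z) c))) := by
      refine commute_tail_of_commute_single (l := (i : ℕ) + 2) (fun a b ha hb y z d c => ?_) hh
        (delta_mem_tail _ _ (by omega))
      rcases lt_trichotomy a b with hab | rfl | hab
      · exact hgt a b (Fin.lt_def.2 (by omega)) hab y z d c
      · exact (commute_delta_self a _ _).map _
      · exact (hgt b a (Fin.lt_def.2 (by omega)) hab z y c d).symm
    change Commute (π (delta i s)) _
    rw [heq, map_mul, map_mul, map_inv, map_inv]
    exact (h1.inv_left.mul_left h2).mul_left h3.inv_left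

/-! ### Iterated commutators with the whole group -/

section Group

variable {G : Type*} [Group G]

/-- The iterated commutators `[N, G, …, G]`, with `s` entries `G`. -/
def iteratedCommutator (N : Subgroup G) : ℕ → Subgroup G
  | 0 => N
  | s + 1 => ⁅iteratedCommutator N s, ⊤⁆

instance iteratedCommutator_normal (N : Subgroup G) [N.Normal] :
    ∀ s, (iteratedCommutator N s).Normal
  | 0 => ‹N.Normal›
  | s + 1 => by
    have := iteratedCommutator_normal N s
    exact inferInstanceAs (⁅iteratedCommutator N s, ⊤⁆ : Subgroup G).Normal

theorem iteratedCommutator_succ' (N : Subgroup G) (s : ℕ) :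
    iteratedCommutator N (s + 1) = iteratedCommutator ⁅N, ⊤⁆ s := by
  induction s with
  | zero => rfl
  | succ s ih => exact congrArg (⁅·, ⊤⁆) ih

theorem iteratedCommutator_top (s : ℕ) :
    iteratedCommutator (⊤ : Subgroup G) s = (⊤ : Subgroup G).lowerCentralSeries s := by
  induction s with
  | zero => rfl
  | succ s ih => exact congrArg (⁅·, ⊤⁆) ih

theorem iteratedCommutator_eq_bot_iff (N : Subgroup G) (s : ℕ) :
    iteratedCommutator N s = ⊥ ↔ N ≤ Subgroup.upperCentralSeries G s := by
  induction s generalizing N with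
  | zero => exact (le_bot_iff (a := N)).symm
  | succ s ih =>
    rw [iteratedCommutator_succ', ih, Subgroup.commutator_le]
    refine forall₂_congr fun x _ => ?_
    rw [Subgroup.mem_upperCentralSeries_succ_iff]
    simp

/-- The three subgroups lemma modulo a normal subgroup. -/
theorem commutator_commutator_le_of_rotate {A B C K : Subgroup G} [K.Normal]
    (h1 : ⁅⁅B, C⁆, A⁆ ≤ K) (h2 : ⁅⁅C, A⁆, B⁆ ≤ K) : ⁅⁅A, B⁆, C⁆ ≤ K := by
  have key : ∀ X : Subgroup G, X ≤ K ↔ X.map (QuotientGroup.mk' K) = ⊥ := fun X => by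
    rw [Subgroup.map_eq_bot_iff, QuotientGroup.ker_mk']
  rw [key, Subgroup.map_commutator, Subgroup.map_commutator] at *
  exact Subgroup.commutator_commutator_eq_bot_of_rotate h1 h2

theorem commutator_iteratedCommutator_le (N : Subgroup G) [N.Normal] (a b : ℕ) :
    ⁅iteratedCommutator N a, (⊤ : Subgroup G).lowerCentralSeries b⁆ ≤
      iteratedCommutator N (a + b + 1) := by
  induction b generalizing a with
  | zero => exact le_rfl
  | succ b ih =>
    rw [Subgroup.commutator_comm, Subgroup.lowerCentralSeries_succ]
    refine commutator_commutator_le_of_rotate ?_ ?_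
    · rw [Subgroup.commutator_comm ⊤, show a + (b + 1) + 1 = a + 1 + b + 1 by ring]
      exact ih (a + 1)
    · exact Subgroup.commutator_mono (ih a) le_rfl

/-- If `G = P N` with `N` normal, then the lower central series of `G` is that of `P` up to iterated
commutators of `N` with `G`. -/
theorem lowerCentralSeries_le_sup (P N : Subgroup G) [N.Normal] (h : P ⊔ N = ⊤) (s : ℕ) :
    (⊤ : Subgroup G).lowerCentralSeries s ≤ P.lowerCentralSeries s ⊔ iteratedCommutator N s := by
  induction s with
  | zero => exact h.ge
  | succ s ih =>
    rw [Subgroup.lowerCentralSeries_succ, Subgroup.commutator_le]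
    intro g hg u _
    obtain ⟨a, ha, t, ht, rfl⟩ := Subgroup.mem_sup_of_normal_right.1 (ih hg)
    obtain ⟨c, hc, v, hv, rfl⟩ := Subgroup.mem_sup_of_normal_right.1 (h ▸ Subgroup.mem_top u)
    set K := iteratedCommutator N (s + 1)
    let π := QuotientGroup.mk' K
    have commute_of_mem : ∀ {x y}, ⁅x, y⁆ ∈ K → Commute (π x) (π y) := fun h =>
      commutatorElement_eq_one_iff_commute.1
        (map_commutatorElement π _ _ ▸ (QuotientGroup.eq_one_iff _).2 h)
    -- Modulo `K`, the factor `t` is central and `v` commutes with `a`.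
    have h1 : ∀ x, Commute (π t) (π x) := fun x =>
      commute_of_mem (Subgroup.commutator_mem_commutator ht (Subgroup.mem_top x))
    have h2 : Commute (π v) (π a) := commute_of_mem <| by
      have := commutator_iteratedCommutator_le N 0 s
      rw [zero_add] at this
      exact this (Subgroup.commutator_mem_commutator hv
        (Subgroup.lowerCentralSeries_mono s le_top ha))
    have h3 : π ⁅a * t, c * v⁆ = π ⁅a, c⁆ := by
      rw [map_commutatorElement, map_commutatorElement, map_mul, map_mul,
        commutatorElement_mul_left_eq_conj_mul,
        (show Commute (π t) (π c * π v) from (h1 c).mul_right (h1 v)).commutator_eq,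
        mul_one, mul_inv_cancel, one_mul, commutatorElement_mul_right_eq_mul_conj,
        h2.symm.commutator_eq, mul_one, mul_assoc, mul_inv_cancel, mul_one]
    have h4 : ⁅a, c⁆⁻¹ * ⁅a * t, c * v⁆ ∈ K := by
      rw [← QuotientGroup.eq_one_iff, ← QuotientGroup.mk'_apply, map_mul, map_inv]
      exact inv_mul_eq_one.2 h3.symm
    have h5 : ⁅a, c⁆ ∈ P.lowerCentralSeries (s + 1) := Subgroup.commutator_mem_commutator ha hc
    have := mul_mem (Subgroup.mem_sup_left (T := K) h5) (Subgroup.mem_sup_right h4)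
    rwa [mul_inv_cancel_left] at this

/-- In a finite `p`-group, a normal subgroup of order at most `p ^ m` is centralized in `m` steps,
since each commutation with the group decreases the order by a factor of at least `p`. -/
theorem iteratedCommutator_eq_bot [Finite G] {p : ℕ} [hp : Fact p.Prime] (hG : IsPGroup p G)
    (N : Subgroup G) [N.Normal] {m : ℕ} (hN : Nat.card N ≤ p ^ m) :
    iteratedCommutator N m = ⊥ := by
  have key : ∀ s, iteratedCommutator N s = ⊥ ∨
      p ^ s * Nat.card (iteratedCommutator N s) ≤ Nat.card N := by
    intro s
    induction s with
    | zero => right; simp [iteratedCommutator]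
    | succ s ih =>
      set H := iteratedCommutator N s
      have hHn : H.Normal := iteratedCommutator_normal N s
      have hle : ⁅H, ⊤⁆ ≤ H := Subgroup.commutator_le_left H ⊤
      change ⁅H, ⊤⁆ = ⊥ ∨ _ * Nat.card (⁅H, ⊤⁆ : Subgroup G) ≤ _
      rcases ih with h0 | ih
      · exact Or.inl (le_bot_iff.1 (h0 ▸ hle))
      by_cases hlt : ⁅H, ⊤⁆ = H
      · left
        obtain ⟨c, hc⟩ := Subgroup.nilpotent_iff_lowerCentralSeries.1 hG.isNilpotent
        have : ∀ r, H ≤ (⊤ : Subgroup G).lowerCentralSeries r := by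
          intro r
          induction r with
          | zero => exact le_top
          | succ r ihr => exact hlt.ge.trans (Subgroup.commutator_mono ihr le_rfl)
        exact le_bot_iff.1 (hle.trans (hc ▸ this c))
      · right
        obtain ⟨r, hr⟩ := (hG.to_subgroup H).index ((⁅H, ⊤⁆ : Subgroup G).subgroupOf H)
        have hr0 : r ≠ 0 := by
          rintro rfl
          exact hlt (le_antisymm hle (Subgroup.relIndex_eq_one.1 hr))
        have hcard := Subgroup.card_mul_index ((⁅H, ⊤⁆ : Subgroup G).subgroupOf H)
        rw [hr, Nat.card_congr (Subgroup.subgroupOfEquivOfLe hle).toEquiv] at hcard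
        calc p ^ (s + 1) * Nat.card (⁅H, ⊤⁆ : Subgroup G)
            = p ^ s * (Nat.card (⁅H, ⊤⁆ : Subgroup G) * p ^ 1) := by ring
          _ ≤ p ^ s * (Nat.card (⁅H, ⊤⁆ : Subgroup G) * p ^ r) := by
              gcongr
              · exact hp.out.one_le
              · omega
          _ ≤ Nat.card N := hcard ▸ ih
  refine (key m).elim id fun h => Subgroup.eq_bot_of_card_le _ ?_
  exact Nat.le_of_mul_le_mul_left (by simpa using h.trans hN) (pow_pos hp.out.pos m)

end Group

/-! ### The abelianization of a tail -/

theorem isPGroup_W [Fact p.Prime] : IsPGroup p (W p n) := by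
  have hbase : ∀ i : Fin n, IsPGroup p (base p i) := by
    rintro i ⟨_, f, rfl⟩
    have hpow : ∀ s : ℕ, delta i f ^ s = delta i (s • f) := by
      intro s
      induction s with
      | zero => simp [delta_zero]
      | succ s ih => rw [pow_succ, ih, succ_nsmul, delta_add]
    refine ⟨1, Subtype.ext ?_⟩
    rw [SubgroupClass.coe_pow, pow_one, hpow]
    have : p • f = 0 := by ext; simp
    rw [this, delta_zero]; rfl
  have htail : ∀ k, k ≤ n → IsPGroup p (tail p n (k + 1)) := by
    intro k hk
    induction hk using Nat.decreasingInduction with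
    | self => rw [tail_eq_bot]; exact IsPGroup.of_bot
    | of_succ k hk ih =>
      refine ((hbase ⟨k, hk⟩).to_sup_of_normal_right ih).to_le fun w hw => ?_
      obtain ⟨f, h, hh, rfl⟩ := exists_eq_delta_mul (i := ⟨k, hk⟩) hw
      exact mul_mem (Subgroup.mem_sup_left ⟨f, rfl⟩) (Subgroup.mem_sup_right hh)
  have := htail 0 n.zero_le
  rw [zero_add, tail_one] at this
  exact this.of_equiv Subgroup.topEquiv

/-- The image of `B_j` in the abelianization of `B_k ⋯ B_n`, for `j ≥ k`, is that of the functions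
supported at the points with vanishing coordinates `k, …, j - 1`. -/
theorem card_map_base_le [Fact p.Prime] {i j : Fin n} (hij : i ≤ j) {K : Subgroup (W p n)}
    [K.Normal] (hK : ⁅tail p n ((i : ℕ) + 1), tail p n ((i : ℕ) + 1)⁆ ≤ K) :
    Nat.card ((base p j).map (QuotientGroup.mk' K)) ≤ p ^ p ^ (i : ℕ) := by
  classical
  have hij' : (i : ℕ) ≤ j := hij
  let ι : ((Fin i → ZMod p) → ZMod p) → (Fin j → ZMod p) → ZMod p := fun g y =>
    if ∀ l : Fin j, (i : ℕ) ≤ l → y l = 0 then g fun l => y (l.castLE hij') else 0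
  let H : Subgroup (W p n) :=
    { carrier := Set.range fun g => delta j (ι g)
      one_mem' := ⟨0, by
        have : ι 0 = 0 := by ext; simp [ι]
        simp [this, delta_zero]⟩
      mul_mem' := by
        rintro _ _ ⟨f, rfl⟩ ⟨g, rfl⟩
        refine ⟨f + g, ?_⟩
        have : ι (f + g) = ι f + ι g := by
          ext y; simp only [ι, Pi.add_apply]; split_ifs <;> simp
        simp only [this, delta_add]
      inv_mem' := by
        rintro _ ⟨f, rfl⟩
        refine ⟨-f, ?_⟩
        have : ι (-f) = -ι f := by
          ext y; simp only [ι, Pi.neg_apply]; split_ifs <;> simp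
        simp only [this, delta_neg] }
  have hle : base p j ≤ K ⊔ H := by
    refine base_le_of_single_mem fun z c => ?_
    let z₀ : Fin n → ZMod p := fun l => if (l : ℕ) < i then z l else 0
    obtain ⟨t, ht, htz, hfix⟩ := exists_mem_tail_apply_eq (x := z) (y := z₀) (i := i)
      (fun l hl => (if_pos hl).symm) j
    have hconj : t * delta j (Pi.single (initial j z) c) * t⁻¹ =
        delta j (Pi.single (initial j z₀) c) := by
      refine conj_delta_eq_of_fix (fun x l hl => hfix x l (Fin.le_def.1 hl.le)) fun x => ?_
      have hz : initial j (t.1 z) = initial j z₀ := initial_eq_iff.2 htz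
      have : initial j ((t⁻¹).1 x) = initial j z ↔ initial j x = initial j z₀ := by
        rw [← hz]
        exact ⟨fun e => by simpa using initial_apply_congr t e,
          fun e => by simpa using initial_apply_congr t⁻¹ e⟩
      simp only [Pi.single_apply, this]
    have hH : delta j (Pi.single (initial j z₀) c) ∈ H := by
      refine ⟨Pi.single (initial i z) c, congrArg _ (funext fun y => ?_)⟩
      have : y = initial j z₀ ↔
          (∀ l : Fin j, (i : ℕ) ≤ l → y l = 0) ∧ (fun l => y (l.castLE hij')) = initial i z := by
        constructor
        · rintro rfl
          refine ⟨fun l hl => if_neg (not_lt.2 hl), funext fun l => if_pos l.isLt⟩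
        · rintro ⟨h1, h2⟩
          funext l
          by_cases hl : (l : ℕ) < i
          · exact (congrFun h2 ⟨l, hl⟩).trans (if_pos (show ((l.castLE j.isLt.le : Fin n) : ℕ) < i
              from hl)).symm
          · exact (h1 l (not_lt.1 hl)).trans (if_neg hl).symm
      simp only [ι, Pi.single_apply, this]
      split_ifs <;> tauto
    have hmem : ⁅t, delta j (Pi.single (initial j z) c)⁆ ∈ K := hK
      (Subgroup.commutator_mem_commutator ht (delta_mem_tail _ _ (by omega)))
    have heq : delta j (Pi.single (initial j z) c) =
        ⁅t, delta j (Pi.single (initial j z) c)⁆⁻¹ * delta j (Pi.single (initial j z₀) c) := by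
      rw [commutatorElement_def, hconj]; group
    rw [heq]
    exact mul_mem (Subgroup.mem_sup_left (inv_mem hmem)) (Subgroup.mem_sup_right hH)
  have hmap : (base p j).map (QuotientGroup.mk' K) ≤ H.map (QuotientGroup.mk' K) := by
    refine (Subgroup.map_mono hle).trans ?_
    rw [Subgroup.map_sup, QuotientGroup.map_mk'_self, bot_sup_eq]
  calc Nat.card ((base p j).map (QuotientGroup.mk' K))
      ≤ Nat.card (H.map (QuotientGroup.mk' K)) := Subgroup.card_le_of_le hmap
    _ ≤ Nat.card H := Nat.le_of_dvd Nat.card_pos (Subgroup.card_map_dvd H _)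
    _ ≤ Nat.card ((Fin i → ZMod p) → ZMod p) := Finite.card_range_le _
    _ = p ^ p ^ (i : ℕ) := by simp

theorem commutator_tail_relIndex_le [Fact p.Prime] (i : Fin n) :
    (⁅tail p n ((i : ℕ) + 1), tail p n ((i : ℕ) + 1)⁆).relIndex (tail p n ((i : ℕ) + 1)) ≤
      (p ^ p ^ (i : ℕ)) ^ (n - i) := by
  set K := ⁅tail p n ((i : ℕ) + 1), tail p n ((i : ℕ) + 1)⁆ with hK
  have hKn : K.Normal := by rw [hK]; infer_instance
  have key : ∀ k, k ≤ n → (i : ℕ) ≤ k →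
      Nat.card ((tail p n (k + 1)).map (QuotientGroup.mk' K)) ≤ (p ^ p ^ (i : ℕ)) ^ (n - k) := by
    intro k hk
    induction hk using Nat.decreasingInduction with
    | self => simp [tail_eq_bot]
    | of_succ k hk ih =>
      intro hik
      have hset : ((tail p n (k + 1)).map (QuotientGroup.mk' K) : Set (W p n ⧸ K)) =
          (base p ⟨k, hk⟩).map (QuotientGroup.mk' K) *
            (tail p n (k + 2)).map (QuotientGroup.mk' K) := by
        rw [Subgroup.coe_map, Subgroup.coe_map, Subgroup.coe_map, ← Set.image_mul]
        exact congrArg _ (coe_tail ⟨k, hk⟩)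
      calc Nat.card ((tail p n (k + 1)).map (QuotientGroup.mk' K))
          = Nat.card (((base p ⟨k, hk⟩).map (QuotientGroup.mk' K) : Set (W p n ⧸ K)) *
            (tail p n (k + 2)).map (QuotientGroup.mk' K) : Set (W p n ⧸ K)) := by
              rw [← hset]; rfl
        _ ≤ _ := Set.natCard_mul_le
        _ ≤ p ^ p ^ (i : ℕ) * (p ^ p ^ (i : ℕ)) ^ (n - (k + 1)) :=
            Nat.mul_le_mul (card_map_base_le (Fin.le_def.2 hik) le_rfl) (ih (by omega))
        _ = (p ^ p ^ (i : ℕ)) ^ (n - k) := by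
            rw [← pow_succ']; congr 1; omega
  have := key i i.isLt.le le_rfl
  rwa [← Subgroup.relIndex_ker, QuotientGroup.ker_mk'] at this

/-! ### The lower central series -/

/-- The complement `B_1 ⋯ B_i` of `B_{i+1} ⋯ B_n`, as the subgroup generated by `B_1, …, B_i`. -/
def head (p n i : ℕ) : Subgroup (W p n) := ⨆ (l : Fin n) (_ : (l : ℕ) < i), base p l

theorem head_sup_tail (i : ℕ) : head p n i ⊔ tail p n (i + 1) = ⊤ := by
  rw [eq_top_iff, ← tail_one]
  refine iSup₂_le fun l _ => ?_
  rcases lt_or_ge (l : ℕ) i with hl | hl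
  · exact le_sup_of_le_left (le_iSup₂_of_le l hl le_rfl)
  · exact le_sup_of_le_right (base_le_tail l (by omega))

theorem head_inf_tail (i : ℕ) : head p n i ⊓ tail p n (i + 1) = ⊥ := by
  let S : Subgroup (W p n) :=
    { carrier := {w | ∀ x (l : Fin n), i ≤ (l : ℕ) → w.1 x l = x l}
      one_mem' := fun x l _ => rfl
      mul_mem' := fun {a b} ha hb x l hl => (ha _ l hl).trans (hb x l hl)
      inv_mem' := fun {a} ha x l hl => by
        have := ha ((a⁻¹ : W p n).1 x) l hl
        rw [← this, apply_inv_apply] }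
  have hS : head p n i ≤ S := by
    refine iSup₂_le fun j hj => ?_
    rintro _ ⟨f, rfl⟩ x l hl
    exact delta_apply_of_ne (fun h => by subst h; omega) _ _
  refine eq_bot_iff.2 fun w ⟨h1, h2⟩ => ext_apply fun x l => ?_
  rcases lt_or_ge (l : ℕ) i with hl | hl
  · exact mem_tail_iff.1 h2 x l hl
  · exact hS h1 x l hl

/-- The image of `T = B_k ⋯ B_n` in `W_n ⧸ [T, T]` is a product of normal subgroups of order at most
`p ^ p ^ (k - 1)`, hence it does not prolong the lower central series of the complement
`B_1 ⋯ B_{k-1}` beyond `p ^ (k - 1)` steps. -/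
theorem lowerCentralSeries_le_commutator_tail_of_head [hp : Fact p.Prime] {i : ℕ} (hi : i < n)
    (hhead : (head p n i).lowerCentralSeries (p ^ i) = ⊥) :
    (⊤ : Subgroup (W p n)).lowerCentralSeries (p ^ i) ≤ ⁅tail p n (i + 1), tail p n (i + 1)⁆ := by
  set T := tail p n (i + 1) with hT
  set K := ⁅T, T⁆ with hK
  have hKn : K.Normal := by rw [hK]; infer_instance
  let π := QuotientGroup.mk' K
  have hsurj : Function.Surjective π := QuotientGroup.mk'_surjective K
  have hbase : ∀ j : Fin n, i + 1 ≤ (j : ℕ) + 1 →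
      (base p j).map π ≤ Subgroup.upperCentralSeries (W p n ⧸ K) (p ^ i) := by
    intro j hj
    have hle : (⊤ : Subgroup (W p n)) ≤
        (Subgroup.normalizer ((base p j).map π : Set (W p n ⧸ K))).comap π := by
      rw [← head_sup_tail i, ← Subgroup.map_le_iff_le_comap, Subgroup.map_sup]
      refine sup_le ?_ ?_
      · rw [Subgroup.le_normalizer_iff_commutator_le_right, ← Subgroup.map_commutator]
        refine Subgroup.map_mono (Subgroup.le_normalizer_iff_commutator_le_right.1 ?_)
        refine iSup₂_le fun l hl => ?_
        have hlj : l < j := Fin.lt_def.2 (by omega)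
        rw [Subgroup.le_normalizer_iff_commutator_le_right, Subgroup.commutator_le]
        rintro _ ⟨g, rfl⟩ _ ⟨f, rfl⟩
        obtain ⟨f', hf'⟩ := delta_conj l j hlj g f
        rw [commutatorElement_def, hf']
        exact mul_mem ⟨f', rfl⟩ (inv_mem ⟨f, rfl⟩)
      · rw [Subgroup.le_normalizer_iff_commutator_le_right, ← Subgroup.map_commutator]
        refine (Subgroup.map_mono (Subgroup.commutator_mono le_rfl (base_le_tail j hj))).trans ?_
        rw [← hT, ← hK, QuotientGroup.map_mk'_self]
        exact bot_le
    have hn : ((base p j).map π).Normal := by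
      rw [← Subgroup.normalizer_eq_top_iff, eq_top_iff]
      intro q _
      obtain ⟨w, rfl⟩ := hsurj q
      exact hle (Subgroup.mem_top w)
    exact (iteratedCommutator_eq_bot_iff _ _).1 (iteratedCommutator_eq_bot
      (isPGroup_W.to_quotient K) _
      (card_map_base_le (i := ⟨i, hi⟩) (Fin.le_def.2 (Nat.le_of_succ_le_succ hj)) le_rfl))
  have hTn : (T.map π).Normal := Subgroup.Normal.map inferInstance π hsurj
  have hTmap : iteratedCommutator (T.map π) (p ^ i) = ⊥ := by
    rw [iteratedCommutator_eq_bot_iff, Subgroup.map_le_iff_le_comap]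
    exact iSup₂_le fun j hj => Subgroup.map_le_iff_le_comap.1 (hbase j hj)
  have hsup : (head p n i).map π ⊔ T.map π = ⊤ := by
    rw [← Subgroup.map_sup, head_sup_tail, Subgroup.map_top_of_surjective _ hsurj]
  have := lowerCentralSeries_le_sup _ _ hsup (p ^ i)
  rw [hTmap, sup_bot_eq, ← Subgroup.map_lowerCentralSeries, hhead, Subgroup.map_bot, le_bot_iff,
    ← Subgroup.map_top_of_surjective _ hsurj, ← Subgroup.map_lowerCentralSeries,
    Subgroup.map_eq_bot_iff, QuotientGroup.ker_mk'] at this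
  exact this

/-- The upper bound for the lower central series. For `k ≥ 2`, by induction,
`γ_{p ^ (k - 2) + 1}(W_n)` is in `B_k ⋯ B_n`, so that the complement `B_1 ⋯ B_{k-1}` has class at
most `p ^ (k - 2)`. -/
theorem lowerCentralSeries_le_commutator_tail [hp : Fact p.Prime] {i : ℕ} (hi : i < n) :
    (⊤ : Subgroup (W p n)).lowerCentralSeries (p ^ i) ≤ ⁅tail p n (i + 1), tail p n (i + 1)⁆ := by
  refine lowerCentralSeries_le_commutator_tail_of_head hi ?_
  rw [← le_bot_iff, ← head_inf_tail i]
  refine le_inf (Subgroup.lowerCentralSeries_le_self _ _) ?_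
  induction i with
  | zero => simp [tail_one]
  | succ i ih =>
    have hle : (head p n i).lowerCentralSeries (p ^ i) = ⊥ := by
      rw [← le_bot_iff, ← head_inf_tail i]
      exact le_inf (Subgroup.lowerCentralSeries_le_self _ _) (ih (by omega))
    calc (head p n (i + 1)).lowerCentralSeries (p ^ (i + 1))
        ≤ (⊤ : Subgroup (W p n)).lowerCentralSeries (p ^ (i + 1)) :=
          Subgroup.lowerCentralSeries_mono _ le_top
      _ ≤ (⊤ : Subgroup (W p n)).lowerCentralSeries (p ^ i) :=
          Subgroup.lowerCentralSeries_antitone _ (Nat.pow_le_pow_right hp.out.pos i.le_succ)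
      _ ≤ ⁅tail p n (i + 1), tail p n (i + 1)⁆ :=
          lowerCentralSeries_le_commutator_tail_of_head (by omega) hle
      _ ≤ tail p n (i + 1 + 1) := commutator_tail_le_tail_succ i

/-- A function that does not depend on the first `i` coordinates gives an element of
`γ_{p ^ i}(W_n)`. In the step from `i` to `i + 1`, each of `p - 1` commutators with the constant
translation of the next coordinate, which is itself an instance of the case `i`, lowers by one the
exponent in the power `x ^ (p - 1)` of that coordinate. -/
theorem delta_mem_lowerCentralSeries [hp : Fact p.Prime] {i : ℕ} {j : Fin n} (hij : i ≤ j)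
    {φ : (Fin j → ZMod p) → ZMod p}
    (hφ : ∀ y y' : Fin j → ZMod p, (∀ l : Fin j, i ≤ (l : ℕ) → y l = y' l) → φ y = φ y') :
    delta j φ ∈ (⊤ : Subgroup (W p n)).lowerCentralSeries (p ^ i - 1) := by
  induction i generalizing j with
  | zero => simp
  | succ i ih =>
    let i' : Fin n := ⟨i, by omega⟩
    let ij : Fin j := ⟨i, hij⟩
    have hij' : i' < j := hij
    have hpi : 1 ≤ p ^ i := Nat.one_le_pow _ _ hp.out.pos
    let ψ (s : ℕ) : ZMod p → ZMod p := (fwdDiff 1)^[s] fun r => r ^ (p - 1)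
    have key : ∀ s : ℕ, delta j (fun y => φ y * ψ s (y ij)) ∈
        (⊤ : Subgroup (W p n)).lowerCentralSeries (p ^ i - 1 + s * p ^ i) := by
      intro s
      induction s with
      | zero =>
        rw [zero_mul, add_zero]
        refine ih (by omega) fun y y' h => ?_
        rw [hφ y y' fun l hl => h l (by omega), h ij le_rfl]
      | succ s ihs =>
        have ht : delta i' (fun _ => (1 : ZMod p)) ∈
            (⊤ : Subgroup (W p n)).lowerCentralSeries (p ^ i - 1) := ih le_rfl fun _ _ _ => rfl
        have hconj := conj_delta_eq hij' (fun _ => (1 : ZMod p))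
          (g := fun y => φ y * ψ s (y ij)) (g' := fun y => φ y * ψ s (y ij + 1)) fun x => by
            have h1 : initial j (Function.update x i' (x i' + 1)) ij = initial j x ij + 1 :=
              Function.update_self _ _ _
            have h2 : φ (initial j (Function.update x i' (x i' + 1))) = φ (initial j x) :=
              hφ _ _ fun l hl => Function.update_of_ne (fun e => by
                have : (l : ℕ) = i := congrArg Fin.val e
                omega) _ _
            rw [h1, h2]
        have hcomm : ⁅delta i' (fun _ => (1 : ZMod p)), delta j (fun y => φ y * ψ s (y ij))⁆ =
            delta j (fun y => φ y * ψ (s + 1) (y ij)) := by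
          rw [commutatorElement_def, hconj, ← delta_neg, ← delta_add]
          congr 1
          funext y
          simp only [ψ, Pi.add_apply, Pi.neg_apply, Function.iterate_succ_apply', fwdDiff]
          ring
        have hle := commutator_iteratedCommutator_le (⊤ : Subgroup (W p n)) (p ^ i - 1)
          (p ^ i - 1 + s * p ^ i)
        rw [iteratedCommutator_top, iteratedCommutator_top,
          show p ^ i - 1 + (p ^ i - 1 + s * p ^ i) + 1 = p ^ i - 1 + (s + 1) * p ^ i by
            rw [add_one_mul]; omega] at hle
        exact hcomm ▸ hle (Subgroup.commutator_mem_commutator ht ihs)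
    have hlast := key (p - 1)
    have hexp : p ^ i - 1 + (p - 1) * p ^ i = p ^ (i + 1) - 1 := by
      rw [Nat.sub_one_mul, pow_succ']
      have := Nat.le_mul_of_pos_left (p ^ i) hp.out.pos
      omega
    -- By Wilson's theorem, the last difference is the constant `(p - 1)! = -1`.
    have hfun : (fun y => φ y * ψ (p - 1) (y ij)) = -φ := by
      funext y
      have : ψ (p - 1) = ((p - 1).factorial : ZMod p → ZMod p) := fwdDiff_iter_eq_factorial
      simp [this, ZMod.wilsons_lemma]
    rw [hexp, hfun, delta_neg] at hlast
    exact inv_mem_iff.1 hlast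

/-- The lower bound for the lower central series. -/
theorem commutator_tail_le_lowerCentralSeries [hp : Fact p.Prime] (i : Fin n) :
    ⁅tail p n ((i : ℕ) + 1), tail p n ((i : ℕ) + 1)⁆ ≤
      (⊤ : Subgroup (W p n)).lowerCentralSeries (p ^ (i : ℕ)) := by
  let u : W p n := delta i fun _ => 1
  have hu : u ∈ tail p n ((i : ℕ) + 1) := delta_mem_tail _ _ le_rfl
  have hM : Subgroup.normalClosure {u} ≤ tail p n ((i : ℕ) + 1) :=
    Subgroup.normalClosure_le_normal (Set.singleton_subset_iff.2 hu)
  have hM' : ¬ Subgroup.normalClosure {u} ≤ tail p n ((i : ℕ) + 2) := fun h => by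
    have := mem_tail_iff.1 (h (Subgroup.subset_normalClosure rfl)) 0 i (Nat.lt_succ_self _)
    rw [delta_apply_self] at this
    simp at this
  have hγ : Subgroup.normalClosure {u} ≤
      (⊤ : Subgroup (W p n)).lowerCentralSeries (p ^ (i : ℕ) - 1) :=
    Subgroup.normalClosure_le_normal (Set.singleton_subset_iff.2
      (delta_mem_lowerCentralSeries le_rfl fun _ _ _ => rfl))
  have hpi : p ^ (i : ℕ) = p ^ (i : ℕ) - 1 + 1 := by
    have := Nat.one_le_pow i p hp.out.pos
    omega
  rw [hpi]
  exact (commutator_tail_le hM hM').trans (Subgroup.commutator_mono hγ le_top)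

theorem lowerCentralSeries_le_of_normal [Fact p.Prime] {i : Fin n} {N : Subgroup (W p n)}
    [N.Normal] (hN : N ≤ tail p n ((i : ℕ) + 1)) (hN' : ¬ N ≤ tail p n ((i : ℕ) + 2)) :
    (⊤ : Subgroup (W p n)).lowerCentralSeries (p ^ (i : ℕ)) ≤ N :=
  (lowerCentralSeries_le_commutator_tail i.isLt).trans
    ((commutator_tail_le hN hN').trans (Subgroup.commutator_le_left N _))

theorem lowerCentralSeries_relIndex_le [Fact p.Prime] {i : Fin n} {N : Subgroup (W p n)}
    (hN : N ≤ tail p n ((i : ℕ) + 1)) :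
    ((⊤ : Subgroup (W p n)).lowerCentralSeries (p ^ (i : ℕ))).relIndex N ≤
      (p ^ p ^ (i : ℕ)) ^ (n - i) :=
  (Subgroup.relIndex_le_of_le_right hN Subgroup.FiniteIndex.index_ne_zero).trans
    ((Subgroup.relIndex_le_of_le_left (commutator_tail_le_lowerCentralSeries i)
      Subgroup.FiniteIndex.index_ne_zero).trans (commutator_tail_relIndex_le i))

end IteratedWreath

theorem mainTheorem4 (p : ℕ) [Fact p.Prime] (hp : p ≠ 2) (n k : ℕ) (hk : 1 ≤ k) (hkn : k ≤ n) :
    (∀ N : Subgroup (IteratedWreath.W p n), N.Normal →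
      N ≤ IteratedWreath.tail p n k → ¬ N ≤ IteratedWreath.tail p n (k + 1) →
        IteratedWreath.gamma (IteratedWreath.W p n) (p ^ (k - 1) + 1) ≤ N ∧
        (IteratedWreath.gamma (IteratedWreath.W p n) (p ^ (k - 1) + 1)).relIndex N ≤
          (p ^ p ^ (k - 1)) ^ (n - k + 1)) ∧
    (∀ (f : (Fin (k - 1) → ZMod p) → ZMod p) (h : IteratedWreath.W p n),
      f ≠ 0 → h ∈ IteratedWreath.tail p n (k + 1) →
        IteratedWreath.gamma (IteratedWreath.W p n) (p ^ (k - 1) + 1) ≤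
          Subgroup.normalClosure
            {IteratedWreath.delta (⟨k - 1, by omega⟩ : Fin n) f * h}) := by
  open IteratedWreath in
  obtain ⟨i, rfl⟩ : ∃ i, k = i + 1 := ⟨k - 1, by omega⟩
  let i' : Fin n := ⟨i, hkn⟩
  simp only [gamma, Nat.add_sub_cancel]
  refine ⟨fun N hN h1 h2 => ⟨lowerCentralSeries_le_of_normal (i := i') h1 h2, ?_⟩,
    fun f h hf hh => lowerCentralSeries_le_of_normal (i := i') ?_ ?_⟩
  · rw [show n - (i + 1) + 1 = n - i by omega]
    exact lowerCentralSeries_relIndex_le (i := i') h1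
  · exact Subgroup.normalClosure_le_normal (Set.singleton_subset_iff.2
      (mul_mem (delta_mem_tail i' f le_rfl) (tail_antitone (Nat.le_succ _) hh)))
  · intro hle
    refine hf (funext fun y => ?_)
    obtain ⟨x, rfl⟩ := initial_surjective i' y
    have h1 : delta i' f ∈ tail p n (i + 1 + 1) :=
      (Subgroup.mul_mem_cancel_right _ hh).1 (hle (Subgroup.subset_normalClosure rfl))
    have := mem_tail_iff.1 h1 x i' (Nat.lt_succ_self i)
    rw [delta_apply_self] at this
    simpa using this
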